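/- Let $p>5$ be a prime and put $$S_p=\sum_{k=0}^{p-1}\frac{\binom{2k}{k}\binom{3k}{k}\binom{6k}{3k}}{54000^k}.$$ Congruences modulo $p^j$ are taken in the ring $R_p$ of rational numbers whose denominator is coprime to $p$, that is, $x\equiv y \pmod{p^j}$ means $x,y\in R_p$ and $x-y\in p^jR_p$. Let $\left(\frac{\cdot}{5}\right)$ be the Legendre symbol modulo $5$. 1. If $p\equiv 2\pmod 3$, then $S_p\equiv 0\pmod{p^2}$. 2. If $p\equiv 1\pmod 3$ and $p=A^2+3B^2$ with integers $A,B$, then $S_p\equiv \left(\frac p5\right)4A^2\pmod p$. -/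

import Mathlib

/-- `R_p`: the ring of rational numbers whose denominator is coprime to `p`, as a predicate. -/
def IsPIntegral (p : ℕ) (x : ℚ) : Prop :=
  Nat.Coprime x.den p

/-- Congruence of rational numbers modulo `p ^ j` in `R_p`: both sides lie in `R_p` and
their difference is `p ^ j` times an element of `R_p`. -/
def PIntegralModEq (p j : ℕ) (x y : ℚ) : Prop :=
  IsPIntegral p x ∧ IsPIntegral p y ∧ ∃ r : ℚ, IsPIntegral p r ∧ x - y = (p : ℚ) ^ j * r

/-- The rational number `∑_{k=0}^{p-1} C(2k,k) C(3k,k) C(6k,3k) / 54000^k`. -/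
def binomSum54000 (p : ℕ) : ℚ :=
  ∑ k ∈ Finset.range p,
    ((Nat.choose (2 * k) k : ℚ) * (Nat.choose (3 * k) k : ℚ) *
      (Nat.choose (6 * k) (3 * k) : ℚ)) / (54000 : ℚ) ^ k

open Polynomial

/-! Clausen's formula turns the sum into a square. Modulo p², the truncated ₃F₂ at (1 - 432x)x
equals the square of the truncated ₂F₁ at x (`clausenPoly_comp`). The equation (1 - 432x)x = 1/54000
has the solution x = (25 - 11√5)/21600, so the computation takes place in (ℤ/p²)[√5].

Modulo p, the truncated ₂F₁ is the X^(p-1) coefficient of a cubic raised to (p-1)/2. Over 𝔽_p[√5]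
this cubic becomes X³ - 15X + 22 by an affine change of variable (`hasseCubic_mul_pow`). The curve
y² = X³ - 15X + 22 is 2-isogenous to y² = x³ + 64, which has complex multiplication by the cube
roots of unity, so its Hasse invariant is -∑ χ(x³ + 64) (`hasseCubic_eq_neg_cubicCharSum`).

If p ≡ 2 mod 3, cubing permutes 𝔽_p and this sum is 0. The truncated ₂F₁ is then a multiple of p,
and its square vanishes modulo p². If p ≡ 1 mod 3, moment identities for ∑ χ(x³ + c) show that the
square of the sum is 4A². The Legendre symbol comes from the factor √5 in the change of variable. -/

/-- The coefficients `(6k)! / (k! (2k)! (3k)!)` of the hypergeometric series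
`₂F₁(1/6, 5/6; 1; 432 x)`. -/
def sexticCoeff (k : ℕ) : ℕ := (3 * k).choose k * (6 * k).choose (3 * k)

/-- The coefficients `(6k)! / ((3k)! k! ^ 3)` of the hypergeometric series
`₃F₂(1/6, 1/2, 5/6; 1, 1; 1728 x)`. -/
def clausenCoeff (k : ℕ) : ℕ := (2 * k).choose k * sexticCoeff k

/-! ### Factorial formulas and recurrences for the coefficients -/

theorem sexticCoeff_mul_factorial (k : ℕ) :
    sexticCoeff k * (k.factorial * (2 * k).factorial * (3 * k).factorial) =
      (6 * k).factorial := by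
  have h1 := Nat.choose_mul_factorial_mul_factorial (show k ≤ 3 * k by omega)
  have h2 := Nat.choose_mul_factorial_mul_factorial (show 3 * k ≤ 6 * k by omega)
  rw [show 3 * k - k = 2 * k by omega] at h1
  rw [show 6 * k - 3 * k = 3 * k by omega] at h2
  rw [← h2, sexticCoeff, ← h1]
  conv_lhs => rw [h1]
  rw [← h1]; ring

theorem clausenCoeff_mul_factorial (k : ℕ) :
    clausenCoeff k * (k.factorial ^ 3 * (3 * k).factorial) = (6 * k).factorial := by
  have h1 := Nat.choose_mul_factorial_mul_factorial (show k ≤ 2 * k by omega)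
  rw [show 2 * k - k = k by omega] at h1
  rw [← sexticCoeff_mul_factorial, clausenCoeff, ← h1]
  ring

theorem sexticCoeff_zero : sexticCoeff 0 = 1 := by simp [sexticCoeff]

theorem clausenCoeff_zero : clausenCoeff 0 = 1 := by simp [clausenCoeff, sexticCoeff]

theorem sexticCoeff_succ (k : ℕ) :
    (k + 1) ^ 2 * sexticCoeff (k + 1) = 12 * (6 * k + 1) * (6 * k + 5) * sexticCoeff k := by
  have h0 := sexticCoeff_mul_factorial k
  have h1 := sexticCoeff_mul_factorial (k + 1)
  rw [show 6 * (k + 1) = 6 * k + 1 + 1 + 1 + 1 + 1 + 1 by ring,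
    show 2 * (k + 1) = 2 * k + 1 + 1 by ring, show 3 * (k + 1) = 3 * k + 1 + 1 + 1 by ring] at h1
  simp only [Nat.factorial_succ] at h1
  rw [← h0] at h1
  have hpos : 0 < 6 * (k + 1) * (2 * k + 1) * (3 * k + 1) * (3 * k + 2) *
    (k.factorial * (2 * k).factorial * (3 * k).factorial) := by positivity
  apply Nat.eq_of_mul_eq_mul_left hpos
  linear_combination h1

theorem clausenCoeff_succ (k : ℕ) :
    (k + 1) ^ 3 * clausenCoeff (k + 1) =
      24 * (2 * k + 1) * (6 * k + 1) * (6 * k + 5) * clausenCoeff k := by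
  have h0 := Nat.succ_mul_centralBinom_succ k
  have h1 := sexticCoeff_succ k
  rw [Nat.centralBinom, Nat.centralBinom] at h0
  rw [clausenCoeff, clausenCoeff]
  calc _ = ((k + 1) * (2 * (k + 1)).choose (k + 1)) * ((k + 1) ^ 2 * sexticCoeff (k + 1)) := by
        ring
    _ = _ := by rw [h0, h1]; ring

/-! ### p-adic valuations of the coefficients -/

section Valuation

variable {p : ℕ}

theorem padicValNat_factorial_eq_div (hp : p.Prime) {m : ℕ} (hm : m < p ^ 2) :
    padicValNat p m.factorial = m / p := by
  have := Fact.mk hp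
  rw [padicValNat_factorial (Nat.log_lt_of_lt_pow' (by norm_num) hm)]
  simp

theorem six_mul_lt_sq (hp5 : 5 < p) {k : ℕ} (hk : k < p) : 6 * k < p ^ 2 := by nlinarith

/-- Legendre's formula has only its first term here, because 6k < p² for k < p and p > 5. -/
theorem padicValNat_sexticCoeff (hp : p.Prime) (hp5 : 5 < p) {k : ℕ} (hk : k < p) :
    padicValNat p (sexticCoeff k) + 2 * k / p + 3 * k / p = 6 * k / p := by
  have := Fact.mk hp
  have h6 := six_mul_lt_sq hp5 hk
  have h := congrArg (padicValNat p) (sexticCoeff_mul_factorial k)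
  have h0 : sexticCoeff k ≠ 0 := fun h => by
    have := sexticCoeff_mul_factorial k
    rw [h, zero_mul] at this
    exact Nat.factorial_ne_zero _ this.symm
  have hf := Nat.factorial_ne_zero
  rw [padicValNat.mul h0 (by simp [hf]), padicValNat.mul (by simp [hf]) (hf _),
    padicValNat.mul (hf _) (hf _), padicValNat_factorial_eq_div hp (by omega),
    padicValNat_factorial_eq_div hp (by omega), padicValNat_factorial_eq_div hp (by omega),
    padicValNat_factorial_eq_div hp h6, Nat.div_eq_of_lt hk] at h
  omega

theorem padicValNat_clausenCoeff (hp : p.Prime) (hp5 : 5 < p) {k : ℕ} (hk : k < p) :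
    padicValNat p (clausenCoeff k) + 3 * k / p = 6 * k / p := by
  have := Fact.mk hp
  have h6 := six_mul_lt_sq hp5 hk
  have h := congrArg (padicValNat p) (clausenCoeff_mul_factorial k)
  have h0 : clausenCoeff k ≠ 0 := fun h => by
    have := clausenCoeff_mul_factorial k
    rw [h, zero_mul] at this
    exact Nat.factorial_ne_zero _ this.symm
  have hf := Nat.factorial_ne_zero
  rw [padicValNat.mul h0 (by simp [hf]), padicValNat.mul (by simp [hf]) (hf _),
    padicValNat.pow, padicValNat_factorial_eq_div hp (by omega),
    padicValNat_factorial_eq_div hp (by omega),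
    padicValNat_factorial_eq_div hp h6, Nat.div_eq_of_lt hk] at h
  omega

theorem dvd_sexticCoeff (hp : p.Prime) (hp5 : 5 < p) {k : ℕ} (hk : k < p) (hk' : p ≤ 6 * k) : p ∣ sexticCoeff k := by
  apply dvd_of_one_le_padicValNat
  have h := padicValNat_sexticCoeff hp hp5 hk
  have h2 : 2 * k / p < 2 := Nat.div_lt_of_lt_mul (by omega)
  have h3 : 3 * k / p < 3 := Nat.div_lt_of_lt_mul (by omega)
  have e2 := Nat.div_mul_le_self (2 * k) p
  have e3 := Nat.div_mul_le_self (3 * k) p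
  have e6 := Nat.lt_div_mul_add (a := 6 * k) hp.pos
  generalize 2 * k / p = q2 at *
  generalize 3 * k / p = q3 at *
  generalize hq6 : 6 * k / p = q6 at *
  by_contra hlt
  have : q6 = q2 + q3 := by omega
  subst this
  interval_cases q2 <;> interval_cases q3 <;> omega

theorem sq_dvd_sexticCoeff (hp : p.Prime) (hp5 : 5 < p) {k : ℕ} (hk : k < p) (hk' : 5 * p ≤ 6 * k) :
    p ^ 2 ∣ sexticCoeff k := by
  have := Fact.mk hp
  apply (pow_dvd_pow p _).trans pow_padicValNat_dvd
  have h := padicValNat_sexticCoeff hp hp5 hk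
  have h2 : 2 * k / p < 2 := Nat.div_lt_of_lt_mul (by omega)
  have h3 : 3 * k / p < 3 := Nat.div_lt_of_lt_mul (by omega)
  have h6 : 5 ≤ 6 * k / p := (Nat.le_div_iff_mul_le hp.pos).2 hk'
  omega

theorem sq_dvd_clausenCoeff (hp : p.Prime) (hp5 : 5 < p) {k : ℕ} (hk : k < p) (hk' : p ≤ 2 * k) :
    p ^ 2 ∣ clausenCoeff k := by
  have := Fact.mk hp
  apply (pow_dvd_pow p _).trans pow_padicValNat_dvd
  have h := padicValNat_clausenCoeff hp hp5 hk
  have h3 : 3 * k / p < 3 := Nat.div_lt_of_lt_mul (by omega)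
  have e3 := Nat.div_mul_le_self (3 * k) p
  have e6 := Nat.lt_div_mul_add (a := 6 * k) hp.pos
  generalize 3 * k / p = q3 at *
  generalize 6 * k / p = q6 at *
  by_contra hlt
  have : q6 = q3 ∨ q6 = q3 + 1 := by omega
  rcases this with hq | hq <;> rw [hq] at e6 <;> interval_cases q3 <;> omega

/-- Either both indices are at least p/6 and each factor contributes one p, or one is below p/6 and
the other exceeds 5p/6 and contributes p². This kills the coefficients of degree at least p in the
squared series. -/
theorem sq_dvd_sexticCoeff_mul (hp : p.Prime) (hp5 : 5 < p) {k l : ℕ} (hk : k < p) (hl : l < p) (hkl : p ≤ k + l) :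
    p ^ 2 ∣ sexticCoeff k * sexticCoeff l := by
  rcases lt_or_ge (6 * k) p with h | h
  · exact (sq_dvd_sexticCoeff hp hp5 hl (by omega)).mul_left _
  rcases lt_or_ge (6 * l) p with h' | h'
  · exact (sq_dvd_sexticCoeff hp hp5 hk (by omega)).mul_right _
  rw [pow_two]
  exact mul_dvd_mul (dvd_sexticCoeff hp hp5 hk h) (dvd_sexticCoeff hp hp5 hl h')

end Valuation

section Coeff

variable {R : Type*} [CommRing R]

theorem coeff_X_mul_derivative (f : R[X]) (m : ℕ) :
    (X * derivative f).coeff m = m * f.coeff m := by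
  cases m with
  | zero => simp
  | succ m => rw [coeff_X_mul, coeff_derivative]; push_cast; ring

theorem coeff_one_sub_C_mul_X_mul_succ (c : R) (f : R[X]) (m : ℕ) :
    ((1 - C c * X) * f).coeff (m + 1) = f.coeff (m + 1) - c * f.coeff m := by
  rw [sub_mul, one_mul, coeff_sub, mul_assoc, coeff_C_mul, coeff_X_mul]

end Coeff

/-! ### Clausen's formula modulo p² via differential equations -/

section Clausen

variable {R : Type*} [CommRing R]

/-- The truncation to degree less than `N` of `∑ sexticCoeff k * X ^ k`. -/
noncomputable def sexticPoly (R : Type*) [CommRing R] (N : ℕ) : R[X] :=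
  ∑ k ∈ Finset.range N, C (sexticCoeff k : R) * X ^ k

/-- The truncation to degree less than `N` of `∑ clausenCoeff k * X ^ k`. -/
noncomputable def clausenPoly (R : Type*) [CommRing R] (N : ℕ) : R[X] :=
  ∑ k ∈ Finset.range N, C (clausenCoeff k : R) * X ^ k

theorem coeff_sexticPoly (N m : ℕ) :
    (sexticPoly R N).coeff m = if m < N then (sexticCoeff m : R) else 0 := by
  simp [sexticPoly, coeff_X_pow]

theorem coeff_clausenPoly (N m : ℕ) :
    (clausenPoly R N).coeff m = if m < N then (clausenCoeff m : R) else 0 := by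
  simp [clausenPoly, coeff_X_pow]

theorem derivative_sexticPoly {N : ℕ} (hN : (N : R) ^ 2 = 0) :
    derivative ((1 - C 432 * X) * (X * derivative (sexticPoly R N))) =
      60 * sexticPoly R N := by
  ext m
  have hs := congrArg (Nat.cast (R := R)) (sexticCoeff_succ m)
  push_cast at hs
  rw [coeff_derivative, coeff_one_sub_C_mul_X_mul_succ, coeff_X_mul_derivative,
    coeff_X_mul_derivative, coeff_sexticPoly, coeff_sexticPoly,
    show (60 : R[X]) = C 60 from rfl, coeff_C_mul, coeff_sexticPoly]
  push_cast
  rcases lt_trichotomy (m + 1) N with h | h | h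
  · rw [if_pos h, if_pos (by omega)]
    linear_combination hs
  -- At the truncation boundary m + 1 = N the recurrence lacks only the term N² · `sexticCoeff N`,
  -- which is zero. This is why truncation at p is harmless modulo p².
  · rw [if_neg (by omega), if_pos (by omega)]
    rw [← h] at hN
    push_cast at hN
    linear_combination hs - sexticCoeff (m + 1) * hN
  · rw [if_neg (by omega), if_neg (by omega)]
    ring

theorem derivative_clausenPoly {N : ℕ} (hN : (N : R) ^ 2 = 0) :
    derivative ((1 - C 1728 * X) * (X * derivative (X * derivative (clausenPoly R N))) -
        C 864 * (X * (X * derivative (clausenPoly R N)))) =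
      240 * (X * derivative (clausenPoly R N)) + 120 * clausenPoly R N := by
  ext m
  have hs := congrArg (Nat.cast (R := R)) (clausenCoeff_succ m)
  push_cast at hs
  rw [coeff_derivative, coeff_sub, coeff_one_sub_C_mul_X_mul_succ, coeff_X_mul_derivative,
    coeff_X_mul_derivative, coeff_X_mul_derivative, coeff_X_mul_derivative, coeff_C_mul,
    coeff_X_mul, coeff_X_mul_derivative, coeff_add,
    show (240 : R[X]) = C 240 from rfl, show (120 : R[X]) = C 120 from rfl, coeff_C_mul,
    coeff_C_mul, coeff_X_mul_derivative, coeff_clausenPoly, coeff_clausenPoly]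
  push_cast
  rcases lt_trichotomy (m + 1) N with h | h | h
  · rw [if_pos h, if_pos (by omega)]
    linear_combination hs
  · rw [if_neg (by omega), if_pos (by omega)]
    rw [← h] at hN
    push_cast at hN
    linear_combination hs - (m + 1) * clausenCoeff (m + 1) * hN
  · rw [if_neg (by omega), if_neg (by omega)]
    ring

/-- The left side minus the right side of the differential equation of the symmetric square. -/
noncomputable def symSquareOp (G : R[X]) : R[X] :=
  derivative ((1 - C 432 * X) * (X * derivative ((1 - C 432 * X) * (X * derivative G)))) -
    240 * ((1 - C 432 * X) * (X * derivative G)) - 120 * ((1 - C 864 * X) * G)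

/-- With P = (1 - 432X)XF' and P' = 60F, one has (1 - 432X)X(F²)' = 2FP, and two further
differentiations close up in F² and FP. -/
theorem symSquareOp_sq {F : R[X]}
    (hF : derivative ((1 - C 432 * X) * (X * derivative F)) = 60 * F) :
    symSquareOp (F ^ 2) = 0 := by
  have h1 : derivative ((1 - C 432 * X) * (X * derivative (F ^ 2))) =
      2 * derivative F * ((1 - C 432 * X) * (X * derivative F)) + 120 * F ^ 2 := by
    have : (1 - C 432 * X) * (X * derivative (F ^ 2)) =
        C 2 * (F * ((1 - C 432 * X) * (X * derivative F))) := by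
      rw [pow_two, derivative_mul, show (C 2 : R[X]) = 2 from rfl]; ring
    rw [this, derivative_C_mul, derivative_mul, hF, show (C 2 : R[X]) = 2 from rfl]; ring
  have h2 : (1 - C 432 * X) * (X * derivative ((1 - C 432 * X) * (X * derivative (F ^ 2)))) =
      C 2 * ((1 - C 432 * X) * (X * derivative F)) ^ 2 +
        C 120 * ((1 - C 432 * X) * X * F ^ 2) := by
    rw [h1, show (C 2 : R[X]) = 2 from rfl, show (C 120 : R[X]) = 120 from rfl]; ring
  rw [symSquareOp, h2, derivative_add, derivative_C_mul, derivative_C_mul, pow_two (_ * _),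
    derivative_mul, hF, derivative_mul, derivative_mul, pow_two F, derivative_mul (f := F)]
  simp only [derivative_sub, derivative_one, derivative_mul, derivative_C, derivative_X]
  rw [show (C 2 : R[X]) = 2 from rfl, show (C 120 : R[X]) = 120 from rfl,
    show (C 432 : R[X]) = 432 from rfl, show (C 864 : R[X]) = 864 from rfl]
  ring

theorem symSquareOp_comp {B : R[X]}
    (hB : derivative ((1 - C 1728 * X) * (X * derivative (X * derivative B)) -
        C 864 * (X * (X * derivative B))) =
      240 * (X * derivative B) + 120 * B) :
    symSquareOp (B.comp ((1 - C 432 * X) * X)) = 0 := by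
  have hc := congrArg (fun f : R[X] => f.comp ((1 - C 432 * X) * X)) hB
  simp only [derivative_sub, derivative_one, derivative_mul, derivative_C, derivative_X,
    add_comp, sub_comp, mul_comp, X_comp, C_comp, one_comp, zero_comp, ofNat_comp,
    derivative_add] at hc
  simp only [symSquareOp, derivative_comp, derivative_sub, derivative_one, derivative_mul,
    derivative_C, derivative_X, derivative_add, derivative_zero]
  generalize B.comp ((1 - C 432 * X) * X) = b0 at *
  generalize (derivative B).comp ((1 - C 432 * X) * X) = b1 at *
  generalize (derivative (derivative B)).comp ((1 - C 432 * X) * X) = b2 at *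
  generalize (derivative (derivative (derivative B))).comp ((1 - C 432 * X) * X) = b3 at *
  rw [show (C 864 : R[X]) = 864 from rfl, show (C 1728 : R[X]) = 1728 from rfl,
    show (C 432 : R[X]) = 432 from rfl] at *
  -- The factor 1 - 864X is the derivative of the inner polynomial (1 - 432X)X, supplied by the
  -- chain rule.
  linear_combination (1 - 864 * X) * hc

theorem symSquareOp_sub (G H : R[X]) :
    symSquareOp (G - H) = symSquareOp G - symSquareOp H := by
  simp only [symSquareOp, derivative_sub, mul_sub]
  ring

/-- Once all lower coefficients vanish, the equation in degree m reads (m + 1)³ D_{m+1} = 0. A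
solution is therefore determined below degree N by its constant term. -/
theorem coeff_eq_zero_of_symSquareOp {D : R[X]} (hD : symSquareOp D = 0) (h0 : D.coeff 0 = 0)
    {N : ℕ} (hN : ∀ m, 0 < m → m < N → IsUnit (m : R)) (m : ℕ) (hm : m < N) :
    D.coeff m = 0 := by
  induction m using Nat.strong_induction_on with
  | _ m ih =>
  rcases m with _ | m
  · exact h0
  have hlow : ∀ j ≤ m, D.coeff j = 0 := fun j hj => ih j (by omega) (by omega)
  have hlow' : ∀ j ≤ m, ((1 - C 432 * X) * (X * derivative D)).coeff j = 0 := by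
    rintro (_ | j) hj
    · simp [mul_coeff_zero]
    · rw [coeff_one_sub_C_mul_X_mul_succ, coeff_X_mul_derivative, coeff_X_mul_derivative,
        hlow _ hj, hlow j (by omega)]
      ring
  have hlast : ((1 - C 864 * X) * D).coeff m = 0 := by
    rcases m with _ | j
    · simp [mul_coeff_zero, h0]
    · rw [coeff_one_sub_C_mul_X_mul_succ, hlow _ le_rfl, hlow j (by omega)]
      ring
  have h := congrArg (fun f : R[X] => f.coeff m) hD
  simp only [symSquareOp, coeff_sub, coeff_zero] at h
  rw [coeff_derivative, coeff_one_sub_C_mul_X_mul_succ, coeff_X_mul_derivative,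
    coeff_X_mul_derivative, hlow' m le_rfl, coeff_one_sub_C_mul_X_mul_succ,
    coeff_X_mul_derivative, coeff_X_mul_derivative, hlow m le_rfl,
    show (240 : R[X]) = C 240 from rfl, show (120 : R[X]) = C 120 from rfl, coeff_C_mul,
    coeff_C_mul, hlow' m le_rfl, hlast] at h
  have hu := (hN (m + 1) (by omega) hm).pow 3
  apply hu.mul_right_eq_zero.1
  push_cast at h ⊢
  linear_combination h

/-- Clausen's formula for the truncated series, modulo `p ^ 2`. -/
theorem clausenPoly_comp {p : ℕ} (hp : p.Prime) (hp5 : 5 < p) [Algebra (ZMod (p ^ 2)) R] :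
    (clausenPoly R p).comp ((1 - C 432 * X) * X) = sexticPoly R p ^ 2 := by
  have hcast : ∀ m : ℕ, (m : R) = algebraMap (ZMod (p ^ 2)) R m := fun m => by simp
  have hzero : ∀ m : ℕ, p ^ 2 ∣ m → (m : R) = 0 := fun m hm => by
    rw [hcast, (ZMod.natCast_eq_zero_iff _ _).2 hm, map_zero]
  have hsq : (p : R) ^ 2 = 0 := by exact_mod_cast hzero (p ^ 2) dvd_rfl
  have hunit : ∀ m, 0 < m → m < p → IsUnit (m : R) := fun m h0 hm => by
    rw [hcast]
    refine IsUnit.map _ ((ZMod.isUnit_iff_coprime _ _).2 ?_)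
    exact (Nat.coprime_of_lt_prime h0.ne' hm hp).symm.pow_right 2
  rw [← sub_eq_zero]
  ext m
  rw [coeff_zero]
  rcases lt_or_ge m p with hm | hm
  · refine coeff_eq_zero_of_symSquareOp ?_ ?_ hunit m hm
    · rw [symSquareOp_sub, symSquareOp_comp (derivative_clausenPoly hsq),
        symSquareOp_sq (derivative_sexticPoly hsq), sub_zero]
    · rw [coeff_sub, coeff_zero_eq_eval_zero, eval_comp, pow_two, mul_coeff_zero,
        coeff_sexticPoly, if_pos hp.pos]
      simp [← coeff_zero_eq_eval_zero, coeff_clausenPoly, hp.pos, clausenCoeff_zero,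
        sexticCoeff_zero]
  -- In degree m ≥ p both sides vanish: on the right by the product divisibility, on the left
  -- because only k with 2k ≥ m ≥ p contribute.
  · rw [coeff_sub, pow_two, coeff_mul, clausenPoly, ← coe_compRingHom_apply, map_sum,
      finsetSum_coeff, Finset.sum_eq_zero, Finset.sum_eq_zero, sub_zero]
    · rintro ⟨i, j⟩ hij
      rw [Finset.HasAntidiagonal.mem_antidiagonal] at hij
      rw [coeff_sexticPoly, coeff_sexticPoly]
      split_ifs with hi hj
      · rw [← Nat.cast_mul]
        exact hzero _ (sq_dvd_sexticCoeff_mul hp hp5 hi hj (by simp only at hij; omega))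
      all_goals simp
    · intro k hk
      rw [Finset.mem_range] at hk
      rw [coe_compRingHom_apply, mul_comp, C_comp, X_pow_comp, coeff_C_mul]
      rcases lt_or_ge (2 * k) m with h | h
      · rw [coeff_eq_zero_of_natDegree_lt, mul_zero]
        refine lt_of_le_of_lt natDegree_pow_le ?_
        have : ((1 - C 432 * X) * X : R[X]).natDegree ≤ 2 := by compute_degree
        nlinarith
      · rw [hzero _ (sq_dvd_clausenCoeff hp hp5 hk (by omega)), zero_mul]

theorem sum_clausenCoeff_mul_pow {p : ℕ} (hp : p.Prime) (hp5 : 5 < p) [Algebra (ZMod (p ^ 2)) R]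
    (x : R) :
    ∑ k ∈ Finset.range p, (clausenCoeff k : R) * ((1 - 432 * x) * x) ^ k =
      (∑ k ∈ Finset.range p, (sexticCoeff k : R) * x ^ k) ^ 2 := by
  have h := congrArg (eval x) (clausenPoly_comp (R := R) hp hp5)
  rw [eval_comp, eval_pow] at h
  simpa [clausenPoly, sexticPoly, eval_finsetSum] using h

end Clausen

/-! ### Hasse invariants and the truncated series modulo p -/

section CharP

variable {p : ℕ} [Fact p.Prime]

theorem ZMod.natCast_ne_zero_of_lt {m : ℕ} (h0 : 0 < m) (hm : m < p) : (m : ZMod p) ≠ 0 := by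
  rw [Ne, ZMod.natCast_eq_zero_iff]
  exact Nat.not_dvd_of_pos_of_lt h0 hm

theorem two_mul_half_add_one (hp5 : 5 < p) : 2 * (p / 2) + 1 = p := by
  have := (Fact.out : p.Prime).eq_two_or_odd
  omega

/-- The central binomial coefficient is (-4)^j times binom(-1/2, j), and -1/2 ≡ (p - 1)/2 modulo p.
-/
theorem centralBinom_eq_choose_half (hp5 : 5 < p) (j : ℕ) (hj : j < p) :
    ((2 * j).choose j : ZMod p) = (p / 2).choose j * (-4) ^ j := by
  induction j with
  | zero => simp
  | succ j ih =>
    have hne := ZMod.natCast_ne_zero_of_lt (p := p) (Nat.succ_pos j) hj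
    have h1 := congrArg (Nat.cast (R := ZMod p)) (Nat.succ_mul_centralBinom_succ j)
    have h2 := Nat.choose_succ_right_eq (p / 2) j
    have hp : ((2 * (p / 2) + 1 : ℕ) : ZMod p) = 0 := by
      rw [two_mul_half_add_one hp5]; simp
    rw [Nat.centralBinom, Nat.centralBinom] at h1
    push_cast at h1 hp hne
    rw [ih (by omega)] at h1
    have h3 : ((p / 2).choose (j + 1) : ZMod p) * (j + 1) =
        (p / 2).choose j * ((p / 2 : ℕ) - j) := by
      rcases le_or_gt j (p / 2) with h | h
      · have := congrArg (Nat.cast (R := ZMod p)) h2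
        rw [Nat.cast_mul, Nat.cast_mul, Nat.cast_sub h] at this
        exact_mod_cast this
      · rw [Nat.choose_eq_zero_of_lt h, Nat.choose_eq_zero_of_lt (by omega)]; simp
    apply mul_left_cancel₀ hne
    rw [h1, pow_succ]
    linear_combination 4 * (-4) ^ j * h3 +
      (p / 2).choose j * (-4) ^ j * 2 * hp

theorem sexticCoeff_eq_choose_half (hp5 : 5 < p) {k : ℕ} (hk : k < p) :
    (sexticCoeff k : ZMod p) =
      (p / 2).choose k * (p / 2 - k).choose (2 * k) * (-64) ^ k := by
  have hp : p.Prime := Fact.out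
  rcases lt_or_ge (3 * k) p with h | h
  · have h1 := centralBinom_eq_choose_half hp5 (3 * k) h
    have h2 := congrArg (Nat.cast (R := ZMod p))
      (Nat.choose_mul (n := p / 2) (show k ≤ 3 * k by omega))
    rw [show 3 * k - k = 2 * k by omega] at h2
    rw [show 2 * (3 * k) = 6 * k by ring, pow_mul, show (-4 : ZMod p) ^ 3 = -64 by norm_num] at h1
    push_cast at h2
    rw [sexticCoeff, Nat.cast_mul, h1, ← h2]
    ring
  · rw [(ZMod.natCast_eq_zero_iff _ _).2 (dvd_sexticCoeff hp hp5 hk (by omega)),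
      Nat.choose_eq_zero_of_lt (n := p / 2 - k) (by omega)]
    simp

/-- Power sums over 𝔽_p vanish except for positive exponents divisible by p - 1, and p - 1 is the
only such exponent in this range. -/
theorem sum_eval_eq_neg_coeff {f : (ZMod p)[X]} (hf : f.natDegree < 2 * (p - 1)) :
    ∑ x, f.eval x = -f.coeff (p - 1) := by
  have hp : p.Prime := Fact.out
  have hp2 := hp.two_le
  have key : ∀ i < 2 * (p - 1), ∑ x : ZMod p, x ^ i = if i = p - 1 then -1 else 0 := by
    intro i hi
    rcases Nat.eq_zero_or_pos i with rfl | h0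
    · rw [if_neg (by omega)]; simp
    have h := FiniteField.sum_pow_units (ZMod p) i
    rw [ZMod.card] at h
    have hs : ∑ x : ZMod p, x ^ i = ∑ x : (ZMod p)ˣ, (x : ZMod p) ^ i := by
      rw [← Finset.sum_subset (s₁ := Finset.univ.erase (0 : ZMod p)) (Finset.subset_univ _)]
      · refine (Finset.sum_bij (fun (x : (ZMod p)ˣ) _ => (x : ZMod p)) ?_ ?_ ?_ ?_).symm
        · simp
        · intro a _ b _ hab
          exact Units.ext hab
        · intro b hb
          exact ⟨Units.mk0 b (Finset.ne_of_mem_erase hb), Finset.mem_univ _, rfl⟩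
        · simp
      · intro x _ hx
        have : x = 0 := by simpa using hx
        rw [this, zero_pow h0.ne']
    rw [hs, h]
    congr 1
    rw [eq_iff_iff]
    refine ⟨fun ⟨c, hc⟩ => ?_, fun h => h ▸ dvd_rfl⟩
    have : c < 2 := by by_contra hcc; nlinarith
    interval_cases c <;> omega
  simp_rw [eval_eq_sum_range' hf]
  rw [Finset.sum_comm]
  simp_rw [← Finset.mul_sum]
  rw [Finset.sum_congr rfl fun i hi => by rw [key i (Finset.mem_range.1 hi)]]
  simp [show 0 < p - 1 by omega]

variable {Q : Type*} [CommRing Q] [Algebra (ZMod p) Q]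

theorem natCast_eq_zero_of_dvd {m : ℕ} (hm : p ∣ m) : (m : Q) = 0 := by
  rw [← map_natCast (algebraMap (ZMod p) Q), (ZMod.natCast_eq_zero_iff _ _).2 hm, map_zero]

/-- By Lucas, binom(m + p - 1, p - 1) is divisible by p for 0 < m ≤ p - 1, so no higher coefficient
leaks into degree p - 1 under translation. -/
theorem coeff_comp_X_add_C (p : ℕ) [Fact p.Prime] [Algebra (ZMod p) Q] {f : Q[X]}
    (hf : f.natDegree ≤ 2 * (p - 1)) (c : Q) :
    (f.comp (X + C c)).coeff (p - 1) = f.coeff (p - 1) := by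
  have hp : p.Prime := Fact.out
  have hp2 := hp.two_le
  rw [← taylor_apply, taylor_coeff]
  have : hasseDeriv (p - 1) f = C (f.coeff (p - 1)) := by
    ext m
    rw [hasseDeriv_coeff, coeff_C]
    split_ifs with h
    · subst h; simp
    · rcases lt_or_ge (2 * (p - 1)) (m + (p - 1)) with h' | h'
      · rw [coeff_eq_zero_of_natDegree_lt (by omega), mul_zero]
      · rw [natCast_eq_zero_of_dvd (p := p), zero_mul]
        have hl := Choose.choose_modEq_choose_mod_mul_choose_div_nat (n := m + (p - 1))
          (k := p - 1) (p := p)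
        have hmod : (m + (p - 1)) % p = m - 1 := by
          rw [show m + (p - 1) = m - 1 + p by omega, Nat.add_mod_right,
            Nat.mod_eq_of_lt (by omega)]
        rw [hmod, Nat.mod_eq_of_lt (show p - 1 < p by omega),
          Nat.choose_eq_zero_of_lt (n := m - 1) (by omega), zero_mul] at hl
        exact Nat.modEq_zero_iff_dvd.1 hl
  rw [this, eval_C]

theorem coeff_one_add_C_mul_X_pow (c : Q) (N m : ℕ) :
    ((1 + C c * X) ^ N : Q[X]).coeff m = N.choose m * c ^ m := by
  have : ((1 + C c * X) ^ N : Q[X]) = ((1 + X) ^ N).comp (C c * X) := by simp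
  rw [this, comp_C_mul_X_coeff, coeff_one_add_X_pow]

/-- The Hasse invariant of `y² = 4X³ + X² - 4x` as a truncated hypergeometric series. -/
theorem coeff_nodal_cubic_pow (hp5 : 5 < p) (x : Q) :
    ((4 * X ^ 3 + X ^ 2 - C (4 * x)) ^ (p / 2) : Q[X]).coeff (p - 1) =
      ∑ k ∈ Finset.range p, (sexticCoeff k : Q) * x ^ k := by
  have hp := two_mul_half_add_one hp5
  set n := p / 2 with hn
  have h0 : (4 * X ^ 3 + X ^ 2 - C (4 * x) : Q[X]) =
      C (-(4 * x)) + X ^ 2 * (1 + C 4 * X) := by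
    rw [show (C 4 : Q[X]) = 4 from rfl, C_neg]; ring
  rw [h0, add_pow, finsetSum_coeff]
  have hsub : Finset.range (n + 1) ⊆ Finset.range p := by
    intro i; simp only [Finset.mem_range]; omega
  have hterm : ∀ k < p, (sexticCoeff k : Q) =
      n.choose k * (n - k).choose (2 * k) * (-64) ^ k := fun k hk => by
    have := congrArg (algebraMap (ZMod p) Q) (sexticCoeff_eq_choose_half hp5 hk)
    rwa [map_mul, map_mul, map_pow, map_neg, map_ofNat, map_natCast, map_natCast,
      map_natCast] at this
  rw [← Finset.sum_subset hsub]
  · refine Finset.sum_congr rfl fun k hk => ?_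
    rw [Finset.mem_range] at hk
    rw [hterm k (by omega), ← C_pow, mul_assoc, coeff_C_mul, mul_pow, ← pow_mul,
      ← C_eq_natCast, coeff_mul_C, coeff_X_pow_mul', if_pos (by omega),
      show p - 1 - 2 * (n - k) = 2 * k by omega, coeff_one_add_C_mul_X_pow]
    have : (-64 : Q) ^ k * x ^ k = (-(4 * x)) ^ k * 4 ^ (2 * k) := by
      rw [pow_mul, ← mul_pow, ← mul_pow]; ring
    linear_combination -(n.choose k : Q) * (n - k).choose (2 * k) * this
  · intro k hk hk'
    rw [Finset.mem_range] at hk hk'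
    rw [hterm k hk, Nat.choose_eq_zero_of_lt (n := n) (by omega)]
    simp

/-- The Hasse invariant of `y² = X³ - 15X + 22`. -/
noncomputable def hasseCubic (p : ℕ) : ZMod p :=
  ((X ^ 3 - 15 * X + 22) ^ (p / 2) : (ZMod p)[X]).coeff (p - 1)

/-- The substitution X ↦ 12wX + w turns X³ - 15X + 22 into 2160w(4X³ + X² - 4x). Translating by w, a
root of the derivative 3X² - 15, removes the linear term. -/
theorem hasseCubic_mul_pow (hp5 : 5 < p) {w x : Q} (hw : w ^ 2 = 5)
    (hx : 8640 * w * x = 10 * w - 22) :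
    algebraMap (ZMod p) Q (hasseCubic p) * (12 * w) ^ (p - 1) =
      (2160 * w) ^ (p / 2) * ∑ k ∈ Finset.range p, (sexticCoeff k : Q) * x ^ k := by
  have hp := two_mul_half_add_one hp5
  have hg : algebraMap (ZMod p) Q (hasseCubic p) =
      ((X ^ 3 - 15 * X + 22) ^ (p / 2) : Q[X]).coeff (p - 1) := by
    rw [hasseCubic, ← coeff_map]
    simp
  have hdeg : ((X ^ 3 - 15 * X + 22) ^ (p / 2) : Q[X]).natDegree ≤ 2 * (p - 1) := by
    refine natDegree_pow_le.trans ?_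
    have : (X ^ 3 - 15 * X + 22 : Q[X]).natDegree ≤ 3 := by compute_degree
    nlinarith [Nat.mul_le_mul_left (p / 2) this, show p - 1 = 2 * (p / 2) by omega]
  have hX := congrArg (C : Q → Q[X]) hx
  have hW := congrArg (C : Q → Q[X]) hw
  simp only [C_mul, C_sub, C_pow, C_ofNat] at hX hW
  rw [hg, ← coeff_comp_X_add_C p hdeg w, ← comp_C_mul_X_coeff, ← coeff_nodal_cubic_pow hp5,
    ← coeff_C_mul, C_pow, ← mul_pow]
  congr 1
  rw [show (15 : Q[X]) = C 15 from rfl, show (22 : Q[X]) = C 22 from rfl]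
  simp only [pow_comp, add_comp, sub_comp, mul_comp, X_comp, C_comp, C_mul]
  simp only [C_ofNat]
  congr 1
  linear_combination (1728 * X ^ 3 * C w + 432 * X ^ 2 * C w + 36 * X * C w + C w) * hW + hX

end CharP

/-! ### Quadratic character sums: 2-isogeny, ∑ χ(x³ + c), and p = s² + 3t² -/

section CharSum

variable {p : ℕ} [Fact p.Prime]

theorem ringChar_zmod_ne_two (hp5 : 5 < p) : ringChar (ZMod p) ≠ 2 := by
  rw [ZMod.ringChar_zmod_n]; omega

theorem hasseCubic_eq_neg_sum (hp5 : 5 < p) :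
    hasseCubic p = -((∑ x : ZMod p, quadraticChar (ZMod p) (x ^ 3 - 15 * x + 22) : ℤ) : ZMod p) := by
  have hp := two_mul_half_add_one hp5
  have hdeg : ((X ^ 3 - 15 * X + 22) ^ (p / 2) : (ZMod p)[X]).natDegree < 2 * (p - 1) := by
    refine natDegree_pow_le.trans_lt ?_
    have : (X ^ 3 - 15 * X + 22 : (ZMod p)[X]).natDegree ≤ 3 := by compute_degree
    have := Nat.mul_le_mul_left (p / 2) this
    omega
  rw [hasseCubic, ← neg_eq_iff_eq_neg, ← sum_eval_eq_neg_coeff hdeg]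
  push_cast
  refine Finset.sum_congr rfl fun x _ => ?_
  rw [quadraticChar_eq_pow_of_char_ne_two' (ringChar_zmod_ne_two hp5), ZMod.card]
  simp

theorem card_roots_quadratic (hp5 : 5 < p) (u b : ZMod p) :
    ((Finset.univ.filter fun x : ZMod p => x ^ 2 - u * x + b = 0).card : ℤ) =
      quadraticChar (ZMod p) (u ^ 2 - 4 * b) + 1 := by
  rw [← quadraticChar_card_sqrts (ringChar_zmod_ne_two hp5)]
  have h2 : (2 : ZMod p) ≠ 0 := by
    exact_mod_cast ZMod.natCast_ne_zero_of_lt (p := p) two_pos (by omega)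
  norm_cast
  refine Finset.card_bij (fun x _ => 2 * x - u) ?_ ?_ ?_
  · intro x hx
    have hx : x ^ 2 - u * x + b = 0 := by simpa using hx
    simp only [Set.mem_toFinset, Set.mem_ofPred_eq]
    linear_combination 4 * hx
  · intro x _ y _ hxy
    exact mul_left_cancel₀ h2 (sub_left_injective hxy)
  · intro y hy
    have hy : y ^ 2 = u ^ 2 - 4 * b := by simpa using hy
    have hinv : 2 * ((y + u) / 2) = y + u := mul_div_cancel₀ _ h2
    refine ⟨(y + u) / 2, ?_, by rw [hinv]; ring⟩
    simp only [Finset.mem_filter, Finset.mem_univ, true_and]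
    have h4 : (4 : ZMod p) ≠ 0 := by
      rw [show (4 : ZMod p) = 2 * 2 by norm_num]; exact mul_ne_zero h2 h2
    apply mul_left_cancel₀ h4
    linear_combination hy + (2 * ((y + u) / 2) + y - u) * hinv

/-- The curves `y² = x³ + a x² + b x` and `y² = x³ - 2 a x² + (a² - 4 b) x`, which are
`2`-isogenous, have the same trace of Frobenius. -/
theorem sum_quadraticChar_two_isogeny (hp5 : 5 < p) (a : ZMod p) {b : ZMod p} (hb : b ≠ 0) :
    ∑ x : ZMod p, quadraticChar (ZMod p) (x ^ 3 + a * x ^ 2 + b * x) =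
      ∑ x : ZMod p, quadraticChar (ZMod p) (x ^ 3 - 2 * a * x ^ 2 + (a ^ 2 - 4 * b) * x) := by
  -- Put u = x + b/x for x ≠ 0: the summand is χ(x²)χ(u + a), and the fibre over u consists of the
  -- roots of x² - ux + b.
  have hleft : ∑ x : ZMod p, quadraticChar (ZMod p) (x ^ 3 + a * x ^ 2 + b * x) =
      ∑ u : ZMod p, quadraticChar (ZMod p) (u + a) *
        ((Finset.univ.filter fun x : ZMod p => x ^ 2 - u * x + b = 0).card : ℤ) := by
    simp_rw [Finset.card_filter, Nat.cast_sum, Finset.mul_sum]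
    rw [Finset.sum_comm]
    refine Finset.sum_congr rfl fun x _ => ?_
    rcases eq_or_ne x 0 with rfl | hx
    · simp [hb]
    · rw [Finset.sum_eq_single ((x ^ 2 + b) / x)]
      · rw [if_pos (by field_simp; ring), Nat.cast_one, mul_one,
          ← mul_one (quadraticChar (ZMod p) ((x ^ 2 + b) / x + a)),
          ← quadraticChar_sq_one' hx, ← map_mul]
        congr 1
        field_simp
        ring
      · intro u _ hu
        rw [if_neg, Nat.cast_zero, mul_zero]
        intro h
        apply hu
        field_simp
        linear_combination -h
      · simp
  have hzero : ∑ u : ZMod p, quadraticChar (ZMod p) (u + a) = 0 := by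
    rw [← quadraticChar_sum_zero (ringChar_zmod_ne_two hp5)]
    exact Equiv.sum_comp (Equiv.addRight a) (quadraticChar (ZMod p))
  rw [hleft]
  simp_rw [card_roots_quadratic hp5, mul_add, mul_one, ← map_mul]
  rw [Finset.sum_add_distrib, hzero, add_zero, ← Equiv.sum_comp (Equiv.subRight a)]
  refine Finset.sum_congr rfl fun x _ => ?_
  congr 1
  simp only [Equiv.subRight_apply]
  ring

/-- The character sum `∑ χ (x³ + c)`. -/
noncomputable def cubicCharSum (c : ZMod p) : ℤ :=
  ∑ x : ZMod p, quadraticChar (ZMod p) (x ^ 3 + c)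

/-- Moving the root 2 of x³ - 15x + 22 to the origin gives x³ + 6x² - 3x. Its 2-isogenous partner is
x³ - 12x² + 48x = (x - 4)³ + 64. -/
theorem hasseCubic_eq_neg_cubicCharSum (hp5 : 5 < p) :
    hasseCubic p = -((cubicCharSum (64 : ZMod p) : ℤ) : ZMod p) := by
  have h3 : (3 : ZMod p) ≠ 0 := by
    exact_mod_cast ZMod.natCast_ne_zero_of_lt (p := p) three_pos (by omega)
  rw [hasseCubic_eq_neg_sum hp5, cubicCharSum, ← Equiv.sum_comp (Equiv.addRight (2 : ZMod p))]
  have h1 : ∀ x : ZMod p, (Equiv.addRight 2 x) ^ 3 - 15 * (Equiv.addRight 2 x) + 22 =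
      x ^ 3 + 6 * x ^ 2 + (-3) * x := fun x => by
    simp only [Equiv.coe_addRight]; ring
  simp_rw [h1]
  rw [sum_quadraticChar_two_isogeny hp5 6 (neg_ne_zero.2 h3),
    ← Equiv.sum_comp (Equiv.addRight (4 : ZMod p))]
  congr 2
  refine Finset.sum_congr rfl fun x _ => ?_
  congr 1
  simp only [Equiv.coe_addRight]
  ring

theorem cubicCharSum_eq_zero_of_two_mod_three (hp5 : 5 < p) (hp3 : p % 3 = 2) (c : ZMod p) :
    cubicCharSum c = 0 := by
  have hinj : Function.Injective fun x : ZMod p => x ^ 3 := by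
    -- The exponent inverts 3 modulo p - 1: its triple is 2p - 1.
    have h : ∀ x : ZMod p, (x ^ 3) ^ (2 * (p / 3) + 1) = x := fun x => by
      rw [← pow_mul, show 3 * (2 * (p / 3) + 1) = p + (p - 1) by omega, pow_add, ZMod.pow_card,
        ← pow_succ', Nat.sub_add_cancel (by omega), ZMod.pow_card]
    intro x y hxy
    rw [← h x, ← h y]
    exact congrArg (· ^ _) hxy
  rw [cubicCharSum, ← quadraticChar_sum_zero (ringChar_zmod_ne_two hp5 : ringChar (ZMod p) ≠ 2)]
  refine Function.Bijective.sum_comp (e := fun x : ZMod p => x ^ 3 + c) ?_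
    (quadraticChar (ZMod p))
  exact Finite.injective_iff_bijective.1 ((add_left_injective c).comp hinj)

theorem cubicCharSum_mul_cube {g : ZMod p} (hg : g ≠ 0) (c : ZMod p) :
    cubicCharSum (c * g ^ 3) = quadraticChar (ZMod p) g * cubicCharSum c := by
  rw [cubicCharSum, cubicCharSum, ← Equiv.sum_comp (Equiv.mulLeft₀ g hg), Finset.mul_sum]
  refine Finset.sum_congr rfl fun x _ => ?_
  rw [← one_mul (quadraticChar (ZMod p) g * _), ← quadraticChar_sq_one' hg, ← map_mul, ← map_mul]
  congr 1
  simp only [Equiv.mulLeft₀_apply]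
  ring

theorem cubicCharSum_zero (hp5 : 5 < p) : cubicCharSum (0 : ZMod p) = 0 := by
  rw [cubicCharSum, ← quadraticChar_sum_zero (ringChar_zmod_ne_two hp5 : ringChar (ZMod p) ≠ 2)]
  refine Finset.sum_congr rfl fun x _ => ?_
  rcases eq_or_ne x 0 with rfl | hx
  · simp
  · rw [add_zero, pow_succ, map_mul, quadraticChar_sq_one' hx, one_mul]

/-- For a ≠ b, the substitution c = (a - b)x - a reduces the sum to χ(-1) times the Jacobi sum J(χ,
χ) = -χ(-1). -/
theorem sum_quadraticChar_mul_shift (hp5 : 5 < p) (a b : ZMod p) :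
    ∑ c : ZMod p, quadraticChar (ZMod p) (a + c) * quadraticChar (ZMod p) (b + c) =
      (if a = b then (p : ℤ) else 0) - 1 := by
  split_ifs with hab
  · subst hab
    have h := Equiv.sum_comp (Equiv.addLeft a)
      (fun c => quadraticChar (ZMod p) c * quadraticChar (ZMod p) c)
    simp only [Equiv.coe_addLeft] at h
    rw [h, ← Finset.sum_erase_add _ _ (Finset.mem_univ (0 : ZMod p)), Finset.sum_congr rfl
      fun x hx => by rw [← pow_two, quadraticChar_sq_one (Finset.ne_of_mem_erase hx)]]
    simp [Finset.card_erase_of_mem, ZMod.card, Nat.cast_sub (Fact.out : p.Prime).one_le]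
  · have hd : a - b ≠ 0 := sub_ne_zero.2 hab
    have hj := jacobiSum_nontrivial_inv (quadraticChar_ne_one (ringChar_zmod_ne_two hp5))
    rw [(quadraticChar_isQuadratic (ZMod p)).inv, jacobiSum] at hj
    rw [← Equiv.sum_comp ((Equiv.mulLeft₀ (a - b) hd).trans (Equiv.subRight a))]
    have h1 : ∀ x : ZMod p,
        quadraticChar (ZMod p) (a + ((Equiv.mulLeft₀ (a - b) hd).trans (Equiv.subRight a)) x) *
        quadraticChar (ZMod p) (b + ((Equiv.mulLeft₀ (a - b) hd).trans (Equiv.subRight a)) x) =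
        quadraticChar (ZMod p) (-1) *
          (quadraticChar (ZMod p) x * quadraticChar (ZMod p) (1 - x)) := fun x => by
      rw [← one_mul (quadraticChar (ZMod p) (-1) * _), ← quadraticChar_sq_one' hd]
      simp only [← map_mul]
      congr 1
      simp only [Equiv.trans_apply, Equiv.subRight_apply, Equiv.mulLeft₀_apply]
      ring
    simp_rw [h1]
    rw [← Finset.mul_sum, hj, mul_neg, ← pow_two, quadraticChar_sq_one (by simp)]
    ring

theorem exists_primitive_cube_root (hp3 : p % 3 = 1) :
    ∃ ω : ZMod p, ω ^ 2 + ω + 1 = 0 := by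
  have := Fact.mk Nat.prime_three
  obtain ⟨u, hu⟩ := exists_prime_orderOf_dvd_card (G := (ZMod p)ˣ) 3
    (by rw [ZMod.card_units_eq_totient, Nat.totient_prime Fact.out]; omega)
  refine ⟨u, ?_⟩
  have h1 : (u : ZMod p) ≠ 1 := fun h => by
    rw [Units.val_eq_one] at h
    rw [h, orderOf_one] at hu
    omega
  have h3 : (u : ZMod p) ^ 3 = 1 := by
    rw [← Units.val_pow_eq_pow_val, ← hu, pow_orderOf_eq_one, Units.val_one]
  apply mul_left_cancel₀ (sub_ne_zero.2 h1)
  linear_combination h3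

theorem card_cube_eq_cube (hp5 : 5 < p) (hp3 : p % 3 = 1) {y : ZMod p} (hy : y ≠ 0) :
    (Finset.univ.filter fun x : ZMod p => x ^ 3 = y ^ 3).card = 3 := by
  obtain ⟨ω, hω⟩ := exists_primitive_cube_root hp3
  have h3 : (3 : ZMod p) ≠ 0 := by
    exact_mod_cast ZMod.natCast_ne_zero_of_lt (p := p) three_pos (by omega)
  have h1 : ω ≠ 1 := by
    rintro rfl
    apply h3
    linear_combination hω
  have h0 : ω ≠ 0 := by
    rintro rfl
    simp at hω
  have h21 : ω ^ 2 ≠ 1 := by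
    intro h
    have : ω = -2 := by linear_combination hω - h
    rw [this] at h
    apply h3
    linear_combination h
  have h2 : ω ^ 2 ≠ ω := by
    intro h
    exact h1 (mul_left_cancel₀ h0 (by linear_combination h))
  have : (Finset.univ.filter fun x : ZMod p => x ^ 3 = y ^ 3) = {y, ω * y, ω ^ 2 * y} := by
    ext x
    simp only [Finset.mem_filter, Finset.mem_univ, true_and, Finset.mem_insert,
      Finset.mem_singleton]
    constructor
    · intro h
      have : (x - y) * ((x - ω * y) * (x - ω ^ 2 * y)) = 0 := by
        linear_combination h + (-x ^ 2 * y + x * y ^ 2 * ω - y ^ 3 * (ω - 1)) * hω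
      rcases mul_eq_zero.1 this with h | h
      · exact Or.inl (sub_eq_zero.1 h)
      rcases mul_eq_zero.1 h with h | h
      · exact Or.inr (Or.inl (sub_eq_zero.1 h))
      · exact Or.inr (Or.inr (sub_eq_zero.1 h))
    · rintro (rfl | rfl | rfl)
      · rfl
      · linear_combination y ^ 3 * (ω - 1) * hω
      · linear_combination y ^ 3 * (ω - 1) * (ω ^ 3 + 1) * hω
  rw [this]
  refine Finset.card_eq_three.2 ⟨_, _, _, ?_, ?_, ?_, rfl⟩
  · intro h; exact h1 (mul_right_cancel₀ hy (by rw [one_mul, ← h]))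
  · intro h; exact h21 (mul_right_cancel₀ hy (by rw [one_mul, ← h]))
  · intro h; exact h2 (mul_right_cancel₀ hy h).symm

theorem sum_quadraticChar_mul_cubicCharSum (hp5 : 5 < p) :
    ∑ c : ZMod p, quadraticChar (ZMod p) c * cubicCharSum c = 0 := by
  simp_rw [cubicCharSum, Finset.mul_sum]
  rw [Finset.sum_comm]
  have h := fun x : ZMod p => sum_quadraticChar_mul_shift hp5 0 (x ^ 3)
  simp only [zero_add] at h
  simp_rw [h]
  rw [Finset.sum_sub_distrib]
  have : ∀ x : ZMod p, (0 = x ^ 3) = (x = 0) := fun x => by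
    rw [eq_comm (a := (0 : ZMod p)), pow_eq_zero_iff (by norm_num)]
  simp [this, ZMod.card]

theorem sum_cubicCharSum_sq (hp5 : 5 < p) (hp3 : p % 3 = 1) :
    ∑ c : ZMod p, cubicCharSum c ^ 2 = 2 * p * (p - 1) := by
  simp_rw [cubicCharSum, pow_two, Finset.sum_mul_sum]
  rw [Finset.sum_comm]
  have h : ∀ y : ZMod p, ∑ c : ZMod p, ∑ x : ZMod p,
      quadraticChar (ZMod p) (y ^ 3 + c) * quadraticChar (ZMod p) (x ^ 3 + c) =
      p * (Finset.univ.filter fun x : ZMod p => x ^ 3 = y ^ 3).card - p := fun y => by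
    rw [Finset.sum_comm]
    simp_rw [sum_quadraticChar_mul_shift hp5, eq_comm (a := y ^ 3)]
    rw [Finset.sum_sub_distrib, ← Finset.sum_filter]
    simp [ZMod.card, mul_comm]
  simp_rw [h]
  rw [← Finset.sum_erase_add _ _ (Finset.mem_univ (0 : ZMod p)), Finset.sum_congr rfl
    fun y hy => by rw [card_cube_eq_cube hp5 hp3 (Finset.ne_of_mem_erase hy)]]
  have : (Finset.univ.filter fun x : ZMod p => x ^ 3 = 0 ^ 3) = {0} := by
    ext x; simp
  rw [this]
  simp [Finset.card_erase_of_mem, ZMod.card, Nat.cast_sub (Fact.out : p.Prime).one_le]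
  ring

/-- The function is constant on the three cosets of the cubes, represented by 1, r and r², each of
size m. -/
theorem sum_eq_of_cube_invariant {r : (ZMod p)ˣ} (hr : ∀ x, x ∈ Subgroup.zpowers r) {m : ℕ}
    (hm : p = 3 * m + 1) {f : ZMod p → ℤ} (h0 : f 0 = 0)
    (hf : ∀ c g : ZMod p, g ≠ 0 → f (c * g ^ 3) = f c) :
    ∑ c, f c = m * (f 1 + f r + f (r ^ 2)) := by
  have hord : orderOf r = 3 * m := by
    rw [orderOf_eq_card_of_forall_mem_zpowers hr, Nat.card_eq_fintype_card,
      ZMod.card_units_eq_totient, Nat.totient_prime Fact.out]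
    omega
  have himage : ∑ u : (ZMod p)ˣ, f u = ∑ k ∈ Finset.range (3 * m), f ((r : ZMod p) ^ k) := by
    rw [← IsCyclic.image_range_orderOf hr, hord, Finset.sum_image]
    · simp
    · intro i hi j hj hij
      apply pow_injOn_Iio_orderOf (x := r) _ _ hij <;> simp_all
  have hunits : ∑ c, f c = ∑ u : (ZMod p)ˣ, f u := by
    rw [← Finset.sum_subset (s₁ := Finset.univ.erase (0 : ZMod p)) (Finset.subset_univ _)]
    · refine (Finset.sum_bij (fun (x : (ZMod p)ˣ) _ => (x : ZMod p)) ?_ ?_ ?_ ?_).symm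
      · simp
      · intro a _ b _ hab
        exact Units.ext hab
      · intro b hb
        exact ⟨Units.mk0 b (Finset.ne_of_mem_erase hb), Finset.mem_univ _, rfl⟩
      · simp
    · intro x _ hx
      have : x = 0 := by simpa using hx
      rw [this, h0]
  rw [hunits, himage]
  clear himage hunits hord hm
  have hper : ∀ k j : ℕ, f ((r : ZMod p) ^ (3 * k + j)) = f ((r : ZMod p) ^ j) := fun k j => by
    rw [add_comm, mul_comm 3 k, pow_add, pow_mul, hf _ _ (pow_ne_zero _ r.ne_zero)]
  induction m with
  | zero => simp
  | succ m ih =>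
    rw [show 3 * (m + 1) = 3 * m + 1 + 1 + 1 by ring, Finset.sum_range_succ,
      Finset.sum_range_succ, Finset.sum_range_succ, ih, ← add_zero (3 * m), hper, add_zero, hper, hper]
    push_cast
    simp only [pow_zero, pow_one]
    ring

/-- All terms are ±1 except at the three roots of x³ = -1, which leaves p - 3 odd terms, an even
number. -/
theorem even_cubicCharSum_one (hp5 : 5 < p) (hp3 : p % 3 = 1) :
    (2 : ℤ) ∣ cubicCharSum (1 : ZMod p) := by
  have hodd := two_mul_half_add_one hp5
  have h : (2 : ℤ) ∣ ∑ x : ZMod p, (quadraticChar (ZMod p) (x ^ 3 + 1) - 1 +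
      if x ^ 3 = (-1) ^ 3 then 1 else 0) := by
    refine Finset.dvd_sum fun x _ => ?_
    split_ifs with hx
    · rw [hx]; norm_num
    · have : x ^ 3 + 1 ≠ 0 := fun h => hx (by linear_combination h)
      rcases quadraticChar_dichotomy this with h | h <;> rw [h] <;> norm_num
  rw [Finset.sum_add_distrib, Finset.sum_sub_distrib, Finset.sum_boole,
    card_cube_eq_cube hp5 hp3 (by simp)] at h
  simp only [Finset.sum_const, Finset.card_univ, ZMod.card, nsmul_eq_mul, mul_one] at h
  rw [cubicCharSum]
  push_cast at h
  omega

/-- On the three cosets of cubes, the moment identities give 2s + T1 + T2 = 0 and 4s² + T1² + T2² =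
6p. Eliminating T2 leaves 3s² + (s + T1)² = 3p, so s + T1 = 3t. -/
theorem cubicCharSum_one_eq (hp5 : 5 < p) (hp3 : p % 3 = 1) :
    ∃ s t : ℤ, cubicCharSum (1 : ZMod p) = 2 * s ∧ (p : ℤ) = s ^ 2 + 3 * t ^ 2 := by
  obtain ⟨r, hr⟩ := IsCyclic.exists_generator (α := (ZMod p)ˣ)
  obtain ⟨m, hm⟩ : ∃ m, p = 3 * m + 1 := ⟨p / 3, by omega⟩
  have hm0 : (m : ℤ) ≠ 0 := by omega
  have h1 := sum_quadraticChar_mul_cubicCharSum hp5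
  have h2 := sum_cubicCharSum_sq hp5 hp3
  rw [sum_eq_of_cube_invariant hr hm (by simp)] at h1
  swap
  · intro c g hg
    rw [cubicCharSum_mul_cube hg, map_mul, map_pow]
    have := quadraticChar_sq_one hg
    linear_combination quadraticChar (ZMod p) c * cubicCharSum c *
      (quadraticChar (ZMod p) g ^ 2 + 1) * this
  rw [sum_eq_of_cube_invariant hr hm (by simp [cubicCharSum_zero hp5])] at h2
  swap
  · intro c g hg
    rw [cubicCharSum_mul_cube hg, mul_pow, quadraticChar_sq_one hg, one_mul]
  have hx1 := quadraticChar_sq_one r.ne_zero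
  have hx2 := quadraticChar_sq_one (pow_ne_zero 2 r.ne_zero)
  have hsum := (mul_eq_zero.1 h1).resolve_left hm0
  have hsq : cubicCharSum (1 : ZMod p) ^ 2 + cubicCharSum (r : ZMod p) ^ 2 +
      cubicCharSum ((r : ZMod p) ^ 2) ^ 2 = 6 * p := by
    apply mul_left_cancel₀ hm0
    rw [h2, show (p : ℤ) = 3 * m + 1 by exact_mod_cast hm]
    ring
  rw [map_one, one_mul] at hsum
  obtain ⟨s, hs⟩ := even_cubicCharSum_one hp5 hp3
  set T1 := quadraticChar (ZMod p) r * cubicCharSum (r : ZMod p) with hT1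
  set T2 := quadraticChar (ZMod p) (r ^ 2) * cubicCharSum ((r : ZMod p) ^ 2) with hT2
  have e1 : T1 ^ 2 = cubicCharSum (r : ZMod p) ^ 2 := by rw [hT1, mul_pow, hx1, one_mul]
  have e2 : T2 ^ 2 = cubicCharSum ((r : ZMod p) ^ 2) ^ 2 := by rw [hT2, mul_pow, hx2, one_mul]
  rw [← e1, ← e2, hs] at hsq
  rw [hs] at hsum
  have hquad : 3 * s ^ 2 + (s + T1) ^ 2 = 3 * p := by
    have : T2 = -(2 * s + T1) := by linear_combination hsum
    rw [this] at hsq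
    linarith
  have h3 : (3 : ℤ) ∣ s + T1 := Int.prime_three.dvd_of_dvd_pow (n := 2)
    ⟨p - s ^ 2, by linear_combination hquad⟩
  obtain ⟨t, ht⟩ := h3
  refine ⟨s, t, hs, ?_⟩
  rw [ht] at hquad
  linarith

/-- The prime q divides (sB - At)(sB + At), and the sign of t is free. Since q² = (sA + 3tB)² + 3(sB
- At)², a multiple of q in the last square must be 0. -/
theorem sq_eq_sq_of_eq_sq_add_three_mul_sq {q : ℕ} (hq : q.Prime) {A B s t : ℤ}
    (h1 : (q : ℤ) = A ^ 2 + 3 * B ^ 2) (h2 : (q : ℤ) = s ^ 2 + 3 * t ^ 2) : s ^ 2 = A ^ 2 := by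
  have hq0 : (0 : ℤ) < q := by exact_mod_cast hq.pos
  have key : ∀ t : ℤ, (q : ℤ) = s ^ 2 + 3 * t ^ 2 → (q : ℤ) ∣ s * B - A * t → s ^ 2 = A ^ 2 := by
    intro t h2 ⟨c, hc⟩
    have h3 : (q : ℤ) ^ 2 = (s * A + 3 * t * B) ^ 2 + 3 * (s * B - A * t) ^ 2 := by
      linear_combination (q : ℤ) * h1 + (A ^ 2 + 3 * B ^ 2) * h2
    rw [hc] at h3
    have hc0 : c = 0 := by
      by_contra hne
      have : 1 ≤ c ^ 2 := by have := pow_pos (abs_pos.2 hne) 2; rw [sq_abs] at this; omega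
      nlinarith [sq_nonneg (s * A + 3 * t * B), pow_pos hq0 2]
    rw [hc0, mul_zero] at hc
    have h4 : (q : ℤ) * (B ^ 2 - t ^ 2) = 0 := by
      linear_combination (s * B + A * t) * hc + B ^ 2 * h2 - t ^ 2 * h1
    have h5 := (mul_eq_zero.1 h4).resolve_left hq0.ne'
    linear_combination h1 - h2 + 3 * h5
  have hdvd : (q : ℤ) ∣ (s * B - A * t) * (s * B - A * (-t)) :=
    ⟨B ^ 2 - t ^ 2, by linear_combination t ^ 2 * h1 - B ^ 2 * h2⟩
  rcases (Nat.prime_iff_prime_int.1 hq).dvd_or_dvd hdvd with h | h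
  · exact key t h2 h
  · exact key (-t) (by rw [h2]; ring) h

theorem hasseCubic_eq_zero (hp5 : 5 < p) (hp3 : p % 3 = 2) : hasseCubic p = 0 := by
  rw [hasseCubic_eq_neg_cubicCharSum hp5, cubicCharSum_eq_zero_of_two_mod_three hp5 hp3]
  simp

theorem hasseCubic_sq (hp5 : 5 < p) (hp3 : p % 3 = 1) {A B : ℤ}
    (h : (p : ℤ) = A ^ 2 + 3 * B ^ 2) : hasseCubic p ^ 2 = 4 * (A : ZMod p) ^ 2 := by
  have h2 : (2 : ZMod p) ≠ 0 := by
    exact_mod_cast ZMod.natCast_ne_zero_of_lt (p := p) two_pos (by omega)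
  have h4 : (4 : ZMod p) = 2 ^ 2 := by norm_num
  have h64 : cubicCharSum (64 : ZMod p) = cubicCharSum (1 : ZMod p) := by
    rw [show (64 : ZMod p) = 1 * 4 ^ 3 by norm_num,
      cubicCharSum_mul_cube (by rw [h4]; exact pow_ne_zero 2 h2), h4, quadraticChar_sq_one' h2,
      one_mul]
  obtain ⟨s, t, hs, ht⟩ := cubicCharSum_one_eq hp5 hp3
  have hsA := congrArg (Int.cast (R := ZMod p))
    (sq_eq_sq_of_eq_sq_add_three_mul_sq Fact.out h ht)
  rw [hasseCubic_eq_neg_cubicCharSum hp5, h64, hs]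
  push_cast at hsA ⊢
  linear_combination 4 * hsA

end CharSum

/-! ### Clearing denominators and specialising Clausen's formula at 1/54000 -/

section Reduction

theorem coprime_of_dvd_thirty_pow {p : ℕ} (hp : p.Prime) (hp5 : 5 < p) {m : ℕ} (k : ℕ)
    (hm : m ∣ 30 ^ k) : m.Coprime p := by
  refine Nat.Coprime.coprime_dvd_left hm (Nat.Coprime.pow_left k ?_)
  rw [Nat.coprime_comm, hp.coprime_iff_not_dvd, show 30 = 2 * (3 * 5) by norm_num, hp.dvd_mul,
    hp.dvd_mul]
  rintro (h | h | h)
  all_goals exact absurd (Nat.le_of_dvd (by norm_num) h) (by omega)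

/-- The integer obtained from the sum by clearing denominators. -/
def clearedSum (p : ℕ) : ℤ :=
  ∑ k ∈ Finset.range p, (clausenCoeff k : ℤ) * 54000 ^ (p - 1 - k)

theorem binomSum54000_eq_div (p : ℕ) :
    binomSum54000 p = (clearedSum p : ℚ) / (54000 : ℚ) ^ (p - 1) := by
  rw [binomSum54000, clearedSum, Int.cast_sum, Finset.sum_div]
  refine Finset.sum_congr rfl fun k hk => ?_
  rw [Finset.mem_range] at hk
  rw [div_eq_div_iff (by positivity) (by positivity), clausenCoeff, sexticCoeff]
  push_cast
  rw [mul_assoc _ _ ((54000 : ℚ) ^ k), ← pow_add, Nat.sub_add_cancel (by omega)]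
  ring

theorem isPIntegral_intCast_div {p D : ℕ} (hD : D.Coprime p) (M : ℤ) :
    IsPIntegral p ((M : ℚ) / D) := by
  refine Nat.Coprime.coprime_dvd_left ?_ hD
  have := Rat.den_dvd M D
  rw [Rat.divInt_eq_div] at this
  exact_mod_cast this

theorem pIntegralModEq_of_dvd {p j D : ℕ} (hD0 : D ≠ 0) (hD : D.Coprime p) {M z : ℤ}
    (h : (p : ℤ) ^ j ∣ M - z * D) : PIntegralModEq p j ((M : ℚ) / D) z := by
  obtain ⟨c, hc⟩ := h
  refine ⟨isPIntegral_intCast_div hD M, ?_, (c : ℚ) / D, isPIntegral_intCast_div hD c, ?_⟩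
  · simp [IsPIntegral]
  · have hc' := congrArg (Int.cast (R := ℚ)) hc
    push_cast at hc'
    have : (D : ℚ) ≠ 0 := by exact_mod_cast hD0
    field_simp
    linear_combination hc'

theorem clearedSum_mul_pow {R : Type*} [CommRing R] (p : ℕ) {e : R} (he : 54000 * e = 1) :
    (clearedSum p : R) * e ^ (p - 1) = ∑ k ∈ Finset.range p, (clausenCoeff k : R) * e ^ k := by
  rw [clearedSum, Int.cast_sum, Finset.sum_mul]
  refine Finset.sum_congr rfl fun k hk => ?_
  rw [Finset.mem_range] at hk
  push_cast
  conv_lhs => rw [show e ^ (p - 1) = e ^ (p - 1 - k) * e ^ k by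
    rw [← pow_add, Nat.sub_add_cancel (by omega)], mul_assoc, ← mul_assoc (54000 ^ _),
    ← mul_pow, he, one_pow, one_mul]

/-- A point where the argument of Clausen's formula equals `1 / 54000`, in terms of a square
root `w` of `5` and an inverse `v` of `30`. -/
def evalPoint {R : Type*} [CommRing R] (w v : R) : R := (25 - 11 * w) * (1125 * v ^ 5)

theorem clausen_arg_evalPoint {R : Type*} [CommRing R] {w v : R} (hw : w ^ 2 = 5)
    (hv : 30 * v = 1) : (1 - 432 * evalPoint w v) * evalPoint w v = 15 * v ^ 4 := by
  have h2 : 900 * v ^ 2 = 1 := by linear_combination (30 * v + 1) * hv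
  have h3 : 27000 * v ^ 3 = 1 := by linear_combination (900 * v ^ 2 + 30 * v + 1) * hv
  have h1 : 1 - 432 * evalPoint w v = v ^ 2 * (450 + 198 * w) := by
    rw [evalPoint]
    linear_combination -h2 - 18 * v ^ 2 * (25 - 11 * w) * h3
  rw [h1, evalPoint]
  linear_combination 15 * v ^ 4 * h3 - 18 * 121 * 1125 * v ^ 7 * hw

theorem evalPoint_mul {R : Type*} [CommRing R] {w v : R} (hw : w ^ 2 = 5) (hv : 30 * v = 1) :
    8640 * w * evalPoint w v = 10 * w - 22 := by
  have h5 : 24300000 * v ^ 5 = 1 := by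
    rw [show (24300000 : R) = 30 ^ 5 by norm_num, ← mul_pow, hv, one_pow]
  rw [evalPoint]
  linear_combination (10 * w - 22) * h5 - 106920000 * v ^ 5 * hw

theorem clearedSum_mul_pow_eq_sq {R : Type*} [CommRing R] {p : ℕ} (hp : p.Prime) (hp5 : 5 < p)
    [Algebra (ZMod (p ^ 2)) R] {w v : R} (hw : w ^ 2 = 5) (hv : 30 * v = 1) :
    (clearedSum p : R) * (15 * v ^ 4) ^ (p - 1) =
      (∑ k ∈ Finset.range p, (sexticCoeff k : R) * evalPoint w v ^ k) ^ 2 := by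
  have he : 54000 * (15 * v ^ 4) = 1 := by
    rw [show 54000 * (15 * v ^ 4) = (30 * v) ^ 4 by ring, hv, one_pow]
  rw [clearedSum_mul_pow p he, ← sum_clausenCoeff_mul_pow hp hp5, clausen_arg_evalPoint hw hv]

variable {p : ℕ} [Fact p.Prime] {Q : Type*} [CommRing Q] [Algebra (ZMod p) Q]

theorem natCast_pow_sub_one_eq_one {m : ℕ} (hm : m.Coprime p) : (m : Q) ^ (p - 1) = 1 := by
  have hm' : (m : ZMod p) ≠ 0 := ((ZMod.isUnit_iff_coprime m p).2 hm).ne_zero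
  have := congrArg (algebraMap (ZMod p) Q) (ZMod.pow_card_sub_one_eq_one hm')
  simpa using this

theorem isUnit_natCast_of_coprime {m : ℕ} (hm : m.Coprime p) : IsUnit (m : Q) := by
  rw [← map_natCast (algebraMap (ZMod p) Q)]
  exact ((ZMod.isUnit_iff_coprime m p).2 hm).map _

theorem sum_sexticCoeff_eq_zero (hp5 : 5 < p) (hp3 : p % 3 = 2) {w v : Q} (hw : w ^ 2 = 5)
    (hv : 30 * v = 1) : ∑ k ∈ Finset.range p, (sexticCoeff k : Q) * evalPoint w v ^ k = 0 := by
  have hp : p.Prime := Fact.out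
  have h := hasseCubic_mul_pow hp5 hw (evalPoint_mul hw hv)
  rw [hasseCubic_eq_zero hp5 hp3, map_zero, zero_mul] at h
  have hw5 : IsUnit w := by
    rw [← isUnit_pow_iff two_ne_zero, hw]
    exact_mod_cast isUnit_natCast_of_coprime (Q := Q)
      (coprime_of_dvd_thirty_pow hp hp5 (m := 5) 1 (by norm_num))
  have h2160 : IsUnit (2160 : Q) := by
    exact_mod_cast isUnit_natCast_of_coprime (Q := Q)
      (coprime_of_dvd_thirty_pow hp hp5 (m := 2160) 4 (by norm_num))
  exact ((h2160.mul hw5).pow _).mul_right_eq_zero.1 h.symm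

theorem sum_sexticCoeff_sq (hp5 : 5 < p) (hp3 : p % 3 = 1) {A B : ℤ}
    (hAB : (p : ℤ) = A ^ 2 + 3 * B ^ 2) {w v : Q} (hw : w ^ 2 = 5) (hv : 30 * v = 1) :
    (∑ k ∈ Finset.range p, (sexticCoeff k : Q) * evalPoint w v ^ k) ^ 2 =
      (@legendreSym 5 ⟨Nat.prime_five⟩ (p : ℤ) : Q) * (4 * (A : Q) ^ 2) := by
  have hp : p.Prime := Fact.out
  have hhalf := two_mul_half_add_one hp5
  have h := congrArg (· ^ 2) (hasseCubic_mul_pow hp5 hw (evalPoint_mul hw hv))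
  have hH : algebraMap (ZMod p) Q (hasseCubic p) ^ 2 = 4 * (A : Q) ^ 2 := by
    rw [← map_pow, hasseCubic_sq hp5 hp3 hAB]
    simp [map_ofNat]
  have h720 : (720 : Q) ^ (p - 1) = 1 := by
    exact_mod_cast natCast_pow_sub_one_eq_one (Q := Q)
      (coprime_of_dvd_thirty_pow hp hp5 (m := 720) 4 (by norm_num))
  have h2160 : (2160 : Q) ^ (p - 1) = 1 := by
    exact_mod_cast natCast_pow_sub_one_eq_one (Q := Q)
      (coprime_of_dvd_thirty_pow hp hp5 (m := 2160) 4 (by norm_num))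
  have e1 : ((12 * w) ^ (p - 1)) ^ 2 = 1 := by
    rw [← pow_mul, mul_comm (p - 1), pow_mul, mul_pow, hw, ← h720]
    norm_num
  -- The odd power of w² = 5 left here is Euler's expression for (5/p), equal to (p/5) by
  -- reciprocity.
  have e2 : ((2160 * w) ^ (p / 2)) ^ 2 = 5 ^ (p / 2) := by
    rw [← pow_mul, mul_pow, show p / 2 * 2 = p - 1 by omega, h2160, one_mul,
      show p - 1 = 2 * (p / 2) by omega, pow_mul, hw]
  have : Fact (Nat.Prime 5) := ⟨Nat.prime_five⟩
  have hleg : ((legendreSym 5 (p : ℤ) : ℤ) : Q) = 5 ^ (p / 2) := by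
    rw [← legendreSym.quadratic_reciprocity_one_mod_four (p := 5) (q := p) (by norm_num)
      (by omega)]
    have := congrArg (algebraMap (ZMod p) Q) (legendreSym.eq_pow p 5)
    simpa [map_ofNat] using this
  have hleg2 : ((legendreSym 5 (p : ℤ) : ℤ) : Q) ^ 2 = 1 := by
    rw [hleg, ← pow_mul, show p / 2 * 2 = p - 1 by omega]
    exact_mod_cast natCast_pow_sub_one_eq_one (Q := Q)
      (coprime_of_dvd_thirty_pow hp hp5 (m := 5) 1 (by norm_num))
  simp only [mul_pow (_ ^ _), mul_pow (algebraMap (ZMod p) Q _), e1, e2, ← hleg, hH] at h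
  rw [← mul_one (4 * (A : Q) ^ 2), h, ← mul_assoc, ← pow_two, hleg2, one_mul]

theorem pIntegralModEq_of_sqrt_five {p : ℕ} (hp : p.Prime) (hp5 : 5 < p) {R : Type*} [CommRing R]
    [Nontrivial R] [Algebra (ZMod (p ^ 2)) R]
    (hinj : Function.Injective (algebraMap (ZMod (p ^ 2)) R)) {w : R} (hw : w ^ 2 = 5) :
    (p % 3 = 2 → PIntegralModEq p 2 (binomSum54000 p) 0) ∧
    (p % 3 = 1 → ∀ A B : ℤ, (p : ℤ) = A ^ 2 + 3 * B ^ 2 →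
      PIntegralModEq p 1 (binomSum54000 p)
        ((@legendreSym 5 ⟨Nat.prime_five⟩ (p : ℤ) : ℚ) * (4 * (A : ℚ) ^ 2))) := by
  have := Fact.mk hp
  have hpR : (p : R) ^ 2 = 0 := by
    rw [← Nat.cast_pow, ← map_natCast (algebraMap (ZMod (p ^ 2)) R), ZMod.natCast_self, map_zero]
  -- The Hasse invariant is only available modulo p, hence in R/pR. Vanishing there means
  -- divisibility by p in R, which squaring lifts to vanishing in R.
  let I : Ideal R := Ideal.span {(p : R)}
  have hI : I ≠ ⊤ := fun h => by
    have hu : IsUnit ((p : R) ^ 2) := (Ideal.span_singleton_eq_top.1 h).pow 2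
    rw [hpR] at hu
    exact not_isUnit_zero hu
  have : Nontrivial (R ⧸ I) := Ideal.Quotient.nontrivial_iff.2 hI
  have hpQ : (p : R ⧸ I) = 0 := by
    rw [← map_natCast (Ideal.Quotient.mk I), Ideal.Quotient.eq_zero_iff_mem]
    exact Ideal.mem_span_singleton_self _
  have : CharP (R ⧸ I) p := (CharP.charP_iff_prime_eq_zero hp).2 hpQ
  let : Algebra (ZMod p) (R ⧸ I) := ZMod.algebra _ p
  have hw' : Ideal.Quotient.mk I w ^ 2 = 5 := by rw [← map_pow, hw, map_ofNat]
  obtain ⟨v, hv⟩ : ∃ v : R, 30 * v = 1 := by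
    have h := ((ZMod.isUnit_iff_coprime 30 (p ^ 2)).2
      ((coprime_of_dvd_thirty_pow hp hp5 1 (by norm_num)).pow_right 2)).map
        (algebraMap (ZMod (p ^ 2)) R)
    obtain ⟨v, hv⟩ := h.exists_right_inv
    exact ⟨v, by rw [← hv]; simp [map_ofNat]⟩
  have hv' : 30 * Ideal.Quotient.mk I v = 1 := by
    rw [← map_ofNat (Ideal.Quotient.mk I) 30, ← map_mul, hv, map_one]
  have hmk : Ideal.Quotient.mk I
      (∑ k ∈ Finset.range p, (sexticCoeff k : R) * evalPoint w v ^ k) =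
      ∑ k ∈ Finset.range p, (sexticCoeff k : R ⧸ I) *
        evalPoint (Ideal.Quotient.mk I w) (Ideal.Quotient.mk I v) ^ k := by
    simp [evalPoint, map_ofNat]
  have hmain := clearedSum_mul_pow_eq_sq hp hp5 hw hv
  have hD : (54000 ^ (p - 1)).Coprime p :=
    (coprime_of_dvd_thirty_pow hp hp5 4 (by norm_num)).pow_left _
  have hS : binomSum54000 p = (clearedSum p : ℚ) / ((54000 ^ (p - 1) : ℕ) : ℚ) := by
    rw [binomSum54000_eq_div]; push_cast; rfl
  have he : ((54000 : R) ^ (p - 1)) * (15 * v ^ 4) ^ (p - 1) = 1 := by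
    rw [← mul_pow, show 54000 * (15 * v ^ 4) = (30 * v) ^ 4 by ring, hv, one_pow, one_pow]
  rw [hS]
  constructor
  · intro h3
    have hzero := sum_sexticCoeff_eq_zero hp5 h3 hw' hv'
    rw [← hmk, Ideal.Quotient.eq_zero_iff_mem, Ideal.mem_span_singleton'] at hzero
    obtain ⟨y, hy⟩ := hzero
    rw [← hy, mul_pow y, hpR, mul_zero] at hmain
    have hM : (clearedSum p : R) = 0 := by linear_combination 54000 ^ (p - 1) * hmain -
      (clearedSum p : R) * he
    replace hM : algebraMap (ZMod (p ^ 2)) R (clearedSum p : ZMod (p ^ 2)) = 0 := by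
      simpa using hM
    replace hM := hinj (hM.trans (map_zero _).symm)
    rw [ZMod.intCast_zmod_eq_zero_iff_dvd] at hM
    have := pIntegralModEq_of_dvd (p := p) (j := 2) (D := 54000 ^ (p - 1)) (M := clearedSum p)
      (z := 0) (by positivity) hD (by simpa using hM)
    simpa using this
  · intro h3 A B hAB
    have hsq := sum_sexticCoeff_sq hp5 h3 hAB hw' hv'
    rw [← hmk, ← map_pow, ← hmain] at hsq
    have he' := congrArg (Ideal.Quotient.mk I) he
    rw [map_mul, map_one] at he'
    rw [map_mul] at hsq
    simp only [map_intCast, map_pow (Ideal.Quotient.mk I) (54000 : R), map_ofNat] at hsq he'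
    set ℓ := @legendreSym 5 ⟨Nat.prime_five⟩ (p : ℤ)
    have hM : ((clearedSum p - ℓ * (4 * A ^ 2) * (54000 ^ (p - 1) : ℕ) : ℤ) : R ⧸ I) = 0 := by
      push_cast
      linear_combination 54000 ^ (p - 1) * hsq - (clearedSum p : R ⧸ I) * he'
    rw [CharP.intCast_eq_zero_iff (R ⧸ I) p] at hM
    have := pIntegralModEq_of_dvd (p := p) (j := 1) (D := 54000 ^ (p - 1)) (M := clearedSum p)
      (z := ℓ * (4 * A ^ 2)) (by positivity) hD (by simpa using hM)
    simpa using this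

end Reduction

theorem theorem4p12 (p : ℕ) (hp : Nat.Prime p) (hp5 : 5 < p) :
    (p ≡ 2 [MOD 3] → PIntegralModEq p 2 (binomSum54000 p) 0) ∧
    (p ≡ 1 [MOD 3] → ∀ A B : ℤ, (p : ℤ) = A ^ 2 + 3 * B ^ 2 →
      PIntegralModEq p 1 (binomSum54000 p)
        ((@legendreSym 5 ⟨Nat.prime_five⟩ (p : ℤ) : ℚ) * (4 * (A : ℚ) ^ 2))) := by
  have : Fact (1 < p ^ 2) := ⟨Nat.one_lt_pow two_ne_zero hp.one_lt⟩
  -- Adjoining a formal root of w² = 5 avoids any case split on whether 5 is a square modulo p.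
  have hw : (⟨0, 1⟩ : QuadraticAlgebra (ZMod (p ^ 2)) 5 0) * ⟨0, 1⟩ = 5 := by
    ext <;> simp [QuadraticAlgebra.re_ofNat, QuadraticAlgebra.im_ofNat]
  exact pIntegralModEq_of_sqrt_five hp hp5 (R := QuadraticAlgebra (ZMod (p ^ 2)) 5 0)
    QuadraticAlgebra.algebraMap_injective ((pow_two _).trans hw)
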